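/- For a convex body $K\subset\mathbb{R}^2$ (a compact convex set with non-empty interior), let $|K|$ be its area, let $\mathrm{Cov}(K)$ be the $2\times 2$ matrix with entries $$\mathrm{Cov}(K)_{ij}=\int_K x_ix_j\,\frac{dx}{|K|}-\int_K x_i\,\frac{dx}{|K|}\int_K x_j\,\frac{dx}{|K|},$$ and let $$\mathcal{C}(K)=\frac{|K|^2}{\det \mathrm{Cov}(K)}.$$ Let $\Delta_{2,0}=\mathrm{co}\{e_1,e_2,-e_1-e_2\}$, where $e_1,e_2$ is the standard basis of $\mathbb{R}^2$ and $\mathrm{co}$ denotes the convex hull. Then for every convex body $K\subset\mathbb{R}^2$, $$\mathcal{C}(K)\ \ge\ \mathcal{C}(\Delta_{2,0})=108,$$ and $\mathcal{C}(T)=108$ for every non-degenerate triangle $T\subset\mathbb{R}^2$. -/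

import Mathlib

open MeasureTheory

namespace PlaneSlicing

/-- The covariance matrix of a set `K` in Euclidean space:
`Cov(K)ᵢⱼ = ∫_K xᵢ xⱼ dx/|K| - (∫_K xᵢ dx/|K|) (∫_K xⱼ dx/|K|)`. -/
noncomputable def cov {n : ℕ} (K : Set (EuclideanSpace ℝ (Fin n))) :
    Matrix (Fin n) (Fin n) ℝ :=
  Matrix.of fun i j =>
    (∫ x in K, x i * x j) / volume.real K
      - ((∫ x in K, x i) / volume.real K) * ((∫ x in K, x j) / volume.real K)

/-- The affine invariant `𝒞(K) = |K|² / det Cov(K)`. -/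
noncomputable def isoC {n : ℕ} (K : Set (EuclideanSpace ℝ (Fin n))) : ℝ :=
  volume.real K ^ 2 / (cov K).det

/-- The simplex `Δₙ,₀ = co {e₁, …, eₙ, -(e₁ + ⋯ + eₙ)}`. -/
noncomputable def simplexZero (n : ℕ) : Set (EuclideanSpace ℝ (Fin n)) :=
  convexHull ℝ
    (insert (-∑ i : Fin n, EuclideanSpace.single i (1 : ℝ))
      (Set.range fun i : Fin n => EuclideanSpace.single i (1 : ℝ)))

end PlaneSlicing

/-! For a convex body, 𝒞(K) is the reciprocal of `ratio K`, which is invariant under nonsingular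
affine maps. The task is therefore to show `ratio K ≤ 1 / 108`, the common value at all triangles.

The engine is Blaschke shaking. If K lies between a convex f and a concave g, sliding its vertical
chords down to the axis preserves the area and changes `momDet` by exactly minus the mixed Gram
determinant of (1, x, f) and (1, x, g) for the weight g - f. By Andréief's identity that determinant
is one sixth of a triple integral of products of two 3×3 determinants. Convexity of f and concavity
of g give these opposite signs, so shaking cannot lower the ratio (`ratio_le_ratio_shake`).

Shaking along both axes and rescaling puts K in the first quadrant, with the unit right triangle
inside it (`IsCornered`). Let S ≥ 1 be the maximum of x + y on such a set. Shaking parallel to the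
hypotenuse and compressing by S yields another cornered set whose area is divided by S
(`exists_shaken`). Cornered sets have area at least 1/2, so one whose area is nearly least, among
those with ratio at least that of K, has S near 1 and is squeezed between two nearly equal triangles
(`exists_near_triangle`). Its moments, hence its ratio, are then close to those of the triangle. No
extremal body has to exist, so no compactness of the space of bodies is used. -/

namespace PlaneSlicing

/-! ### Moments and affine invariance -/

section

/-- The moment `∫_K xⁱ yʲ` of a planar set. -/
noncomputable def mom (i j : ℕ) (K : Set (ℝ × ℝ)) : ℝ := ∫ p in K, p.1 ^ i * p.2 ^ j

/-- The determinant of the matrix of moments of `1, x, y` on a planar set. -/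
noncomputable def momDet (K : Set (ℝ × ℝ)) : ℝ :=
  mom 0 0 K * (mom 2 0 K * mom 0 2 K - mom 1 1 K ^ 2)
    - mom 1 0 K * (mom 1 0 K * mom 0 2 K - mom 1 1 K * mom 0 1 K)
    + mom 0 1 K * (mom 1 0 K * mom 1 1 K - mom 2 0 K * mom 0 1 K)

/-- The affine invariant `det Cov(K) / |K|²`, written through moments. -/
noncomputable def ratio (K : Set (ℝ × ℝ)) : ℝ := momDet K / mom 0 0 K ^ 5

/-- The affine self-map `(x, y) ↦ (a x + b y + e, c x + d y + k)` of the plane. -/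
noncomputable def planeMap (a b c d e k : ℝ) : (ℝ × ℝ) →ᵃ[ℝ] (ℝ × ℝ) where
  toFun p := (a * p.1 + b * p.2 + e, c * p.1 + d * p.2 + k)
  linear := Matrix.toLin (Module.Basis.finTwoProd ℝ) (Module.Basis.finTwoProd ℝ) !![a, b; c, d]
  map_vadd' p v := by
    simp only [Matrix.toLin_finTwoProd_apply, vadd_eq_add, Prod.fst_add, Prod.snd_add,
      Prod.mk_add_mk, Prod.mk.injEq]
    constructor <;> ring

theorem planeMap_apply (a b c d e k : ℝ) (p : ℝ × ℝ) :
    planeMap a b c d e k p = (a * p.1 + b * p.2 + e, c * p.1 + d * p.2 + k) := rfl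

theorem continuous_planeMap (a b c d e k : ℝ) : Continuous (planeMap a b c d e k) := by
  have : (planeMap a b c d e k : ℝ × ℝ → ℝ × ℝ) =
      fun p => (a * p.1 + b * p.2 + e, c * p.1 + d * p.2 + k) := rfl
  rw [this]
  fun_prop

theorem injective_planeMap {a b c d : ℝ} (e k : ℝ) (h : a * d - b * c ≠ 0) :
    Function.Injective (planeMap a b c d e k) := by
  rintro ⟨x, y⟩ ⟨x', y'⟩ hp
  simp only [planeMap_apply, Prod.mk.injEq] at hp
  obtain ⟨h1, h2⟩ := hp
  have hx : (a * d - b * c) * (x - x') = 0 := by linear_combination d * h1 - b * h2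
  have hy : (a * d - b * c) * (y - y') = 0 := by linear_combination a * h2 - c * h1
  have hx' := (mul_eq_zero.1 hx).resolve_left h
  have hy' := (mul_eq_zero.1 hy).resolve_left h
  ext <;> simp <;> linarith

theorem setIntegral_planeMap_image {a b c d : ℝ} (e k : ℝ) (h : a * d - b * c ≠ 0)
    {K : Set (ℝ × ℝ)} (hK : MeasurableSet K) (F : ℝ × ℝ → ℝ) :
    ∫ p in planeMap a b c d e k '' K, F p =
      |a * d - b * c| * ∫ p in K, F (planeMap a b c d e k p) := by
  have hd : ∀ p ∈ K, HasFDerivWithinAt (planeMap a b c d e k)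
      (LinearMap.toContinuousLinearMap (Matrix.toLin (Module.Basis.finTwoProd ℝ)
        (Module.Basis.finTwoProd ℝ) !![a, b; c, d])) K p := by
    intro p _
    rw [Matrix.toLin_finTwoProd_toContinuousLinearMap]
    have : (planeMap a b c d e k : ℝ × ℝ → ℝ × ℝ) =
      fun p => (a * p.1 + b * p.2 + e, c * p.1 + d * p.2 + k) := rfl
    rw [this]
    have h1 : HasFDerivAt (fun p : ℝ × ℝ => p.1) (ContinuousLinearMap.fst ℝ ℝ ℝ) p := hasFDerivAt_fst
    have h2 : HasFDerivAt (fun p : ℝ × ℝ => p.2) (ContinuousLinearMap.snd ℝ ℝ ℝ) p := hasFDerivAt_snd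
    exact ((((h1.const_mul a).add (h2.const_mul b)).add_const e).prodMk
      (((h1.const_mul c).add (h2.const_mul d)).add_const k)).hasFDerivWithinAt
  rw [integral_image_eq_integral_abs_det_fderiv_smul volume hK hd
    (injective_planeMap e k h).injOn]
  have hdet : (LinearMap.toContinuousLinearMap (Matrix.toLin (Module.Basis.finTwoProd ℝ)
        (Module.Basis.finTwoProd ℝ) !![a, b; c, d])).det = a * d - b * c := by
    rw [LinearMap.det_toContinuousLinearMap, LinearMap.det_toLin, Matrix.det_fin_two_of]
  simp only [hdet, smul_eq_mul, integral_const_mul]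

theorem integrableOn_monomial {K : Set (ℝ × ℝ)} (hK : IsCompact K) (i j : ℕ) :
    IntegrableOn (fun p : ℝ × ℝ => p.1 ^ i * p.2 ^ j) K :=
  (by fun_prop : Continuous fun p : ℝ × ℝ => p.1 ^ i * p.2 ^ j).continuousOn.integrableOn_compact hK

theorem setIntegral_quadratic {K : Set (ℝ × ℝ)} (hK : IsCompact K) (c₀ c₁ c₂ c₃ c₄ c₅ : ℝ) :
    ∫ p in K, (c₀ * (p.1 ^ 0 * p.2 ^ 0) + c₁ * (p.1 ^ 1 * p.2 ^ 0) + c₂ * (p.1 ^ 0 * p.2 ^ 1)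
      + c₃ * (p.1 ^ 2 * p.2 ^ 0) + c₄ * (p.1 ^ 1 * p.2 ^ 1) + c₅ * (p.1 ^ 0 * p.2 ^ 2)) =
    c₀ * mom 0 0 K + c₁ * mom 1 0 K + c₂ * mom 0 1 K + c₃ * mom 2 0 K + c₄ * mom 1 1 K
      + c₅ * mom 0 2 K := by
  have I := fun (c : ℝ) i j => (integrableOn_monomial hK i j).const_mul c
  rw [integral_add _ (I _ _ _), integral_add _ (I _ _ _), integral_add _ (I _ _ _),
    integral_add _ (I _ _ _), integral_add (I _ _ _) (I _ _ _)]
  · simp only [integral_const_mul, mom]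
  · exact (I _ _ _).add (I _ _ _)
  · exact ((I _ _ _).add (I _ _ _)).add (I _ _ _)
  · exact (((I _ _ _).add (I _ _ _)).add (I _ _ _)).add (I _ _ _)
  · exact ((((I _ _ _).add (I _ _ _)).add (I _ _ _)).add (I _ _ _)).add (I _ _ _)

/-- `H` expands the pulled-back monomial in degree at most two, so the new moment is a combination
of the six old ones. -/
theorem mom_planeMap_image {a b c d : ℝ} (e k : ℝ) (h : a * d - b * c ≠ 0)
    {K : Set (ℝ × ℝ)} (hK : IsCompact K) {i j : ℕ} (c₀ c₁ c₂ c₃ c₄ c₅ : ℝ)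
    (H : ∀ x y : ℝ, (a * x + b * y + e) ^ i * (c * x + d * y + k) ^ j =
      c₀ + c₁ * x + c₂ * y + c₃ * x ^ 2 + c₄ * (x * y) + c₅ * y ^ 2) :
    mom i j (planeMap a b c d e k '' K) = |a * d - b * c| *
      (c₀ * mom 0 0 K + c₁ * mom 1 0 K + c₂ * mom 0 1 K + c₃ * mom 2 0 K + c₄ * mom 1 1 K
      + c₅ * mom 0 2 K) := by
  rw [mom, setIntegral_planeMap_image e k h hK.measurableSet, ← setIntegral_quadratic hK]
  congr 1
  refine integral_congr_ae (Filter.Eventually.of_forall fun p => ?_)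
  simp only [planeMap_apply, H]
  ring

theorem area_planeMap_image {a b c d : ℝ} (e k : ℝ) (h : a * d - b * c ≠ 0)
    {K : Set (ℝ × ℝ)} (hK : IsCompact K) :
    mom 0 0 (planeMap a b c d e k '' K) = |a * d - b * c| * mom 0 0 K := by
  rw [mom_planeMap_image e k h hK 1 0 0 0 0 0 (fun x y => by ring)]
  ring

theorem ratio_planeMap_image {a b c d : ℝ} (e k : ℝ) (h : a * d - b * c ≠ 0)
    {K : Set (ℝ × ℝ)} (hK : IsCompact K) :
    ratio (planeMap a b c d e k '' K) = ratio K := by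
  have hdet : momDet (planeMap a b c d e k '' K) = |a * d - b * c| ^ 5 * momDet K := by
    -- The Jacobian enters once for each row of the 3×3 moment matrix; the congruence by the change
    -- of basis of 1, x, y contributes the squared determinant.
    have h5 : |a * d - b * c| ^ 5 = |a * d - b * c| ^ 3 * (a * d - b * c) ^ 2 := by
      rw [← sq_abs (a * d - b * c)]; ring
    rw [h5]
    simp only [momDet]
    rw [area_planeMap_image e k h hK,
      mom_planeMap_image (i := 1) (j := 0) e k h hK e a b 0 0 0 (fun x y => by ring),
      mom_planeMap_image (i := 0) (j := 1) e k h hK k c d 0 0 0 (fun x y => by ring),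
      mom_planeMap_image (i := 2) (j := 0) e k h hK (e ^ 2) (2 * a * e) (2 * b * e) (a ^ 2)
        (2 * a * b) (b ^ 2) (fun x y => by ring),
      mom_planeMap_image (i := 1) (j := 1) e k h hK (e * k) (a * k + c * e) (b * k + d * e) (a * c)
        (a * d + b * c) (b * d) (fun x y => by ring),
      mom_planeMap_image (i := 0) (j := 2) e k h hK (k ^ 2) (2 * c * k) (2 * d * k) (c ^ 2)
        (2 * c * d) (d ^ 2) (fun x y => by ring)]
    ring
  have h0 : |a * d - b * c| ^ 5 ≠ 0 := pow_ne_zero _ (abs_ne_zero.2 h)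
  rw [ratio, hdet, area_planeMap_image e k h hK, mul_pow, mul_div_mul_left _ _ h0, ratio]

end

/-! ### Blaschke shaking and vertical sections -/

section

/-- The lower end of the vertical section of `K` over `x`. -/
noncomputable def lowerEnd (K : Set (ℝ × ℝ)) (x : ℝ) : ℝ := sInf {y | (x, y) ∈ K}

/-- The upper end of the vertical section of `K` over `x`. -/
noncomputable def upperEnd (K : Set (ℝ × ℝ)) (x : ℝ) : ℝ := sSup {y | (x, y) ∈ K}

/-- Blaschke shaking: the vertical sections of `K` are moved down onto the axis `y = 0`. -/
def shake (K : Set (ℝ × ℝ)) : Set (ℝ × ℝ) :=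
  (fun r : (ℝ × ℝ) × (ℝ × ℝ) => (r.1.1, r.2.2 - r.1.2)) ''
    ((K ×ˢ K) ∩ {r | r.1.1 = r.2.1 ∧ r.1.2 ≤ r.2.2})

variable {K : Set (ℝ × ℝ)}

theorem mem_shake {x y : ℝ} :
    (x, y) ∈ shake K ↔ 0 ≤ y ∧ ∃ z, (x, z) ∈ K ∧ (x, z + y) ∈ K := by
  constructor
  · rintro ⟨⟨⟨a, b⟩, ⟨c, d⟩⟩, ⟨⟨h1, h2⟩, h3, h4⟩, h5⟩
    simp only [Prod.mk.injEq] at h1 h2 h3 h4 h5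
    obtain ⟨rfl, rfl⟩ := h5
    subst h3
    exact ⟨by linarith, b, h1, by simpa using h2⟩
  · rintro ⟨h0, z, h1, h2⟩
    exact ⟨((x, z), (x, z + y)), ⟨⟨h1, h2⟩, rfl, by simpa using h0⟩, by simp⟩

theorem isCompact_shake (hK : IsCompact K) : IsCompact (shake K) := by
  refine IsCompact.image ((hK.prod hK).inter_right ?_) (by fun_prop)
  have h₁ : IsClosed {r : (ℝ × ℝ) × (ℝ × ℝ) | r.1.1 = r.2.1} :=
    isClosed_eq (by fun_prop) (by fun_prop)
  have h₂ : IsClosed {r : (ℝ × ℝ) × (ℝ × ℝ) | r.1.2 ≤ r.2.2} :=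
    isClosed_le (by fun_prop) (by fun_prop)
  exact h₁.inter h₂

theorem convex_shake (hK : Convex ℝ K) : Convex ℝ (shake K) := by
  rintro ⟨x, y⟩ h ⟨x', y'⟩ h' a b ha hb hab
  rw [mem_shake] at h h'
  obtain ⟨h0, z, h1, h2⟩ := h
  obtain ⟨h0', z', h1', h2'⟩ := h'
  simp only [Prod.smul_mk, smul_eq_mul, Prod.mk_add_mk]
  rw [mem_shake]
  refine ⟨by positivity, a * z + b * z', hK h1 h1' ha hb hab, ?_⟩
  convert hK h2 h2' ha hb hab using 1
  simp only [Prod.smul_mk, smul_eq_mul, Prod.mk_add_mk, Prod.mk.injEq, true_and]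
  ring

theorem isCompact_section (hK : IsCompact K) (x : ℝ) : IsCompact {y | (x, y) ∈ K} := by
  have : {y | (x, y) ∈ K} = Prod.snd '' (K ∩ {p | p.1 = x}) := by
    ext y
    constructor
    · intro h
      exact ⟨(x, y), ⟨h, rfl⟩, rfl⟩
    · rintro ⟨⟨a, b⟩, ⟨h1, h2⟩, rfl⟩
      simp only [Set.mem_ofPred_eq] at h2 ⊢
      rwa [← h2]
  rw [this]
  exact (hK.inter_right (isClosed_eq (by fun_prop) (by fun_prop))).image continuous_snd

theorem section_nonempty {x : ℝ} (hx : x ∈ Prod.fst '' K) : {y | (x, y) ∈ K}.Nonempty := by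
  obtain ⟨⟨a, b⟩, h, rfl⟩ := hx
  exact ⟨b, h⟩

theorem lowerEnd_mem (hK : IsCompact K) {x : ℝ} (hx : x ∈ Prod.fst '' K) :
    (x, lowerEnd K x) ∈ K :=
  (isCompact_section hK x).sInf_mem (section_nonempty hx)

theorem upperEnd_mem (hK : IsCompact K) {x : ℝ} (hx : x ∈ Prod.fst '' K) :
    (x, upperEnd K x) ∈ K :=
  (isCompact_section hK x).sSup_mem (section_nonempty hx)

theorem lowerEnd_le (hK : IsCompact K) {x y : ℝ} (h : (x, y) ∈ K) : lowerEnd K x ≤ y :=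
  csInf_le (isCompact_section hK x).bddBelow h

theorem le_upperEnd (hK : IsCompact K) {x y : ℝ} (h : (x, y) ∈ K) : y ≤ upperEnd K x :=
  le_csSup (isCompact_section hK x).bddAbove h

theorem lowerEnd_le_upperEnd (hK : IsCompact K) {x : ℝ} (hx : x ∈ Prod.fst '' K) :
    lowerEnd K x ≤ upperEnd K x :=
  lowerEnd_le hK (upperEnd_mem hK hx)

theorem section_eq_Icc (hK : IsCompact K) (hc : Convex ℝ K) {x : ℝ} (hx : x ∈ Prod.fst '' K) :
    {y | (x, y) ∈ K} = Set.Icc (lowerEnd K x) (upperEnd K x) := by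
  ext y
  refine ⟨fun h => ⟨lowerEnd_le hK h, le_upperEnd hK h⟩, fun h => ?_⟩
  have hs : Convex ℝ {y | (x, y) ∈ K} := by
    intro y₁ h₁ y₂ h₂ a b ha hb hab
    have := hc h₁ h₂ ha hb hab
    simp only [Prod.smul_mk, smul_eq_mul, Prod.mk_add_mk, ← add_mul, hab, one_mul] at this
    exact this
  exact hs.ordConnected.out (lowerEnd_mem hK hx) (upperEnd_mem hK hx) h

theorem measurable_lowerEnd (hK : IsCompact K) : Measurable (lowerEnd K) := by
  refine measurable_of_Iic fun c => ?_
  have hI : MeasurableSet (Prod.fst '' K) := (hK.image continuous_fst).measurableSet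
  have hJ : MeasurableSet (Prod.fst '' (K ∩ {p : ℝ × ℝ | p.2 ≤ c})) :=
    ((hK.inter_right (isClosed_le (by fun_prop) (by fun_prop))).image continuous_fst).measurableSet
  -- Off the projection of K the section is empty and `sInf ∅ = 0`, which accounts for the second
  -- set of the union.
  have : lowerEnd K ⁻¹' Set.Iic c =
      Prod.fst '' (K ∩ {p : ℝ × ℝ | p.2 ≤ c}) ∪ ((Prod.fst '' K)ᶜ ∩ {_x | 0 ≤ c}) := by
    ext x
    by_cases hx : x ∈ Prod.fst '' K
    · simp only [Set.mem_preimage, Set.mem_Iic, Set.mem_union, Set.mem_inter_iff,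
        Set.mem_compl_iff, hx, not_true_eq_false, false_and, or_false]
      constructor
      · intro h
        exact ⟨_, ⟨lowerEnd_mem hK hx, h⟩, rfl⟩
      · rintro ⟨⟨a, b⟩, ⟨h1, h2⟩, rfl⟩
        exact (lowerEnd_le hK h1).trans h2
    · have h0 : {y | (x, y) ∈ K} = ∅ := by
        ext y
        simp only [Set.mem_ofPred_eq, Set.mem_empty_iff_false, iff_false]
        exact fun h => hx ⟨_, h, rfl⟩
      have h1 : x ∉ Prod.fst '' (K ∩ {p : ℝ × ℝ | p.2 ≤ c}) := by
        rintro ⟨p, ⟨hp, _⟩, rfl⟩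
        exact hx ⟨p, hp, rfl⟩
      simp only [Set.mem_preimage, Set.mem_Iic, Set.mem_union, Set.mem_inter_iff,
        Set.mem_compl_iff, hx, h1, not_false_eq_true, true_and, false_or, Set.mem_ofPred_eq,
        lowerEnd, h0, Real.sInf_empty]
  rw [this]
  exact hJ.union (hI.compl.inter (MeasurableSet.const _))

theorem measurable_upperEnd (hK : IsCompact K) : Measurable (upperEnd K) := by
  refine measurable_of_Ici fun c => ?_
  have hI : MeasurableSet (Prod.fst '' K) := (hK.image continuous_fst).measurableSet
  have hJ : MeasurableSet (Prod.fst '' (K ∩ {p : ℝ × ℝ | c ≤ p.2})) :=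
    ((hK.inter_right (isClosed_le (by fun_prop) (by fun_prop))).image continuous_fst).measurableSet
  have : upperEnd K ⁻¹' Set.Ici c =
      Prod.fst '' (K ∩ {p : ℝ × ℝ | c ≤ p.2}) ∪ ((Prod.fst '' K)ᶜ ∩ {_x | c ≤ 0}) := by
    ext x
    by_cases hx : x ∈ Prod.fst '' K
    · simp only [Set.mem_preimage, Set.mem_Ici, Set.mem_union, Set.mem_inter_iff,
        Set.mem_compl_iff, hx, not_true_eq_false, false_and, or_false]
      constructor
      · intro h
        exact ⟨_, ⟨upperEnd_mem hK hx, h⟩, rfl⟩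
      · rintro ⟨⟨a, b⟩, ⟨h1, h2⟩, rfl⟩
        exact le_trans h2 (le_upperEnd hK h1)
    · have h0 : {y | (x, y) ∈ K} = ∅ := by
        ext y
        simp only [Set.mem_ofPred_eq, Set.mem_empty_iff_false, iff_false]
        exact fun h => hx ⟨_, h, rfl⟩
      have h1 : x ∉ Prod.fst '' (K ∩ {p : ℝ × ℝ | c ≤ p.2}) := by
        rintro ⟨p, ⟨hp, _⟩, rfl⟩
        exact hx ⟨p, hp, rfl⟩
      simp only [Set.mem_preimage, Set.mem_Ici, Set.mem_union, Set.mem_inter_iff,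
        Set.mem_compl_iff, hx, h1, not_false_eq_true, true_and, false_or, Set.mem_ofPred_eq,
        upperEnd, h0, Real.sSup_empty]
  rw [this]
  exact hJ.union (hI.compl.inter (MeasurableSet.const _))

/-- Fubini's theorem on a compact set with interval sections. -/
theorem setIntegral_eq_of_sections (hK : IsCompact K) {I : Set ℝ} (hI : MeasurableSet I)
    {f g : ℝ → ℝ} (hfg : ∀ x ∈ I, f x ≤ g x)
    (h : ∀ x y, (x, y) ∈ K ↔ x ∈ I ∧ y ∈ Set.Icc (f x) (g x)) {F : ℝ × ℝ → ℝ}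
    (hF : Continuous F) :
    ∫ p in K, F p = ∫ x in I, ∫ y in (f x)..(g x), F (x, y) := by
  have hint : Integrable (K.indicator F) (volume.prod volume) :=
    (hF.continuousOn.integrableOn_compact hK).integrable_indicator hK.measurableSet
  rw [← integral_indicator hK.measurableSet, Measure.volume_eq_prod, integral_prod _ hint,
    ← integral_indicator hI]
  refine integral_congr_ae (Filter.Eventually.of_forall fun x => ?_)
  by_cases hx : x ∈ I
  · simp only [Set.indicator_of_mem hx]
    rw [intervalIntegral.integral_of_le (hfg x hx), ← integral_Icc_eq_integral_Ioc,
      ← integral_indicator measurableSet_Icc]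
    refine integral_congr_ae (Filter.Eventually.of_forall fun y => ?_)
    simp only [Set.indicator, h, hx, true_and]
  · simp only [Set.indicator_of_notMem hx]
    simp [Set.indicator, h, hx]

theorem mom_eq_of_sections (hK : IsCompact K) {I : Set ℝ} (hI : MeasurableSet I)
    {f g : ℝ → ℝ} (hfg : ∀ x ∈ I, f x ≤ g x)
    (h : ∀ x y, (x, y) ∈ K ↔ x ∈ I ∧ y ∈ Set.Icc (f x) (g x)) (i j : ℕ) :
    mom i j K = ∫ x in I, x ^ i * ((g x ^ (j + 1) - f x ^ (j + 1)) / (j + 1)) := by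
  rw [mom, setIntegral_eq_of_sections hK hI hfg h (by fun_prop)]
  simp only [intervalIntegral.integral_const_mul, integral_pow]

theorem mem_iff_sections (hK : IsCompact K) (hc : Convex ℝ K) (x y : ℝ) :
    (x, y) ∈ K ↔ x ∈ Prod.fst '' K ∧ y ∈ Set.Icc (lowerEnd K x) (upperEnd K x) := by
  constructor
  · intro h
    exact ⟨⟨_, h, rfl⟩, lowerEnd_le hK h, le_upperEnd hK h⟩
  · rintro ⟨hx, hy⟩
    rw [← section_eq_Icc hK hc hx] at hy
    exact hy

theorem mem_shake_iff_sections (hK : IsCompact K) (hc : Convex ℝ K) (x y : ℝ) :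
    (x, y) ∈ shake K ↔
      x ∈ Prod.fst '' K ∧ y ∈ Set.Icc 0 (upperEnd K x - lowerEnd K x) := by
  rw [mem_shake]
  constructor
  · rintro ⟨h0, z, h1, h2⟩
    refine ⟨⟨_, h1, rfl⟩, h0, ?_⟩
    linarith [lowerEnd_le hK h1, le_upperEnd hK h2]
  · rintro ⟨hx, h0, h1⟩
    refine ⟨h0, lowerEnd K x, lowerEnd_mem hK hx, ?_⟩
    rw [mem_iff_sections hK hc]
    exact ⟨hx, by linarith, by linarith⟩

end

/-! ### Shaking does not decrease the moment determinant -/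

section

/-- The determinant of the rows `(1, xᵢ, yᵢ)`, `i = 1, 2, 3`. -/
def tripleDet (x₁ x₂ x₃ y₁ y₂ y₃ : ℝ) : ℝ :=
  y₁ * (x₃ - x₂) + y₂ * (x₁ - x₃) + y₃ * (x₂ - x₁)

/-- Permuting the points multiplies both determinants by the same sign, so the product is symmetric
and the ordered case suffices. -/
theorem tripleDet_mul_nonpos {I : Set ℝ} {f g : ℝ → ℝ}
    (hf : ∀ x₁ ∈ I, ∀ x₂ ∈ I, ∀ x₃ ∈ I, x₁ ≤ x₂ → x₂ ≤ x₃ →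
      0 ≤ tripleDet x₁ x₂ x₃ (f x₁) (f x₂) (f x₃))
    (hg : ∀ x₁ ∈ I, ∀ x₂ ∈ I, ∀ x₃ ∈ I, x₁ ≤ x₂ → x₂ ≤ x₃ →
      tripleDet x₁ x₂ x₃ (g x₁) (g x₂) (g x₃) ≤ 0) :
    ∀ x₁ ∈ I, ∀ x₂ ∈ I, ∀ x₃ ∈ I,
      tripleDet x₁ x₂ x₃ (f x₁) (f x₂) (f x₃) * tripleDet x₁ x₂ x₃ (g x₁) (g x₂) (g x₃) ≤ 0 := by
  intro a ha b hb c hc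
  have key : ∀ x₁ ∈ I, ∀ x₂ ∈ I, ∀ x₃ ∈ I, x₁ ≤ x₂ → x₂ ≤ x₃ →
      tripleDet x₁ x₂ x₃ (f x₁) (f x₂) (f x₃) * tripleDet x₁ x₂ x₃ (g x₁) (g x₂) (g x₃) ≤ 0 :=
    fun x₁ h₁ x₂ h₂ x₃ h₃ h h' =>
      mul_nonpos_of_nonneg_of_nonpos (hf x₁ h₁ x₂ h₂ x₃ h₃ h h') (hg x₁ h₁ x₂ h₂ x₃ h₃ h h')
  rcases le_total a b with h | h <;> rcases le_total b c with h' | h' <;>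
    rcases le_total a c with h'' | h''
  · exact key a ha b hb c hc h h'
  · exact key a ha b hb c hc h h'
  · convert key a ha c hc b hb h'' h' using 1; simp only [tripleDet]; ring
  · convert key c hc a ha b hb h'' h using 1; simp only [tripleDet]; ring
  · convert key b hb a ha c hc h h'' using 1; simp only [tripleDet]; ring
  · convert key b hb c hc a ha h' h'' using 1; simp only [tripleDet]; ring
  · convert key c hc b hb a ha h' h using 1; simp only [tripleDet]; ring
  · convert key c hc b hb a ha h' h using 1; simp only [tripleDet]; ring

/-- The integrals of `xⁱ f(x)ʲ g(x)ᵏ` over `I` with weight `g - f`. -/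
noncomputable def gapMoment (I : Set ℝ) (f g : ℝ → ℝ) (i j k : ℕ) : ℝ :=
  ∫ x in I, x ^ i * f x ^ j * g x ^ k * (g x - f x)

section

variable {I : Set ℝ} {f g : ℝ → ℝ}

theorem setIntegral_gap_quadratic
    (hint : ∀ i j k, IntegrableOn (fun x => x ^ i * f x ^ j * g x ^ k * (g x - f x)) I)
    (c₀ c₁ c₂ c₃ c₄ c₅ c₆ c₇ c₈ c₉ : ℝ) :
    ∫ x in I, (c₀ + c₁ * x + c₂ * f x + c₃ * g x + c₄ * x ^ 2 + c₅ * (x * f x) + c₆ * (x * g x)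
      + c₇ * (f x * g x) + c₈ * f x ^ 2 + c₉ * g x ^ 2) * (g x - f x) =
    c₀ * gapMoment I f g 0 0 0 + c₁ * gapMoment I f g 1 0 0 + c₂ * gapMoment I f g 0 1 0
      + c₃ * gapMoment I f g 0 0 1 + c₄ * gapMoment I f g 2 0 0 + c₅ * gapMoment I f g 1 1 0
      + c₆ * gapMoment I f g 1 0 1 + c₇ * gapMoment I f g 0 1 1 + c₈ * gapMoment I f g 0 2 0
      + c₉ * gapMoment I f g 0 0 2 := by
  have J := fun (c : ℝ) i j k => (hint i j k).const_mul c
  simp only [gapMoment, ← integral_const_mul]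
  repeat rw [← integral_add]
  · refine integral_congr_ae (Filter.Eventually.of_forall fun x => ?_)
    ring
  all_goals repeat' first | exact J _ _ _ _ | refine Integrable.add ?_ ?_

theorem gap_quadratic_nonpos (hI : MeasurableSet I) (hfg : ∀ x ∈ I, f x ≤ g x)
    (hint : ∀ i j k, IntegrableOn (fun x => x ^ i * f x ^ j * g x ^ k * (g x - f x)) I)
    {c₀ c₁ c₂ c₃ c₄ c₅ c₆ c₇ : ℝ}
    (h : ∀ x ∈ I, c₀ + c₁ * x + c₂ * f x + c₃ * g x + c₄ * x ^ 2 + c₅ * (x * f x)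
      + c₆ * (x * g x) + c₇ * (f x * g x) ≤ 0) :
    c₀ * gapMoment I f g 0 0 0 + c₁ * gapMoment I f g 1 0 0 + c₂ * gapMoment I f g 0 1 0
      + c₃ * gapMoment I f g 0 0 1 + c₄ * gapMoment I f g 2 0 0 + c₅ * gapMoment I f g 1 1 0
      + c₆ * gapMoment I f g 1 0 1 + c₇ * gapMoment I f g 0 1 1 ≤ 0 := by
  have e := setIntegral_gap_quadratic hint c₀ c₁ c₂ c₃ c₄ c₅ c₆ c₇ 0 0
  simp only [zero_mul, add_zero] at e
  rw [← e]
  exact setIntegral_nonpos hI fun x hx =>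
    mul_nonpos_of_nonpos_of_nonneg (h x hx) (sub_nonneg.2 (hfg x hx))

/-- The mixed Gram determinant of `1, x, f` and `1, x, g` is nonpositive, by Andréief's identity. -/
theorem gap_gram_nonpos (hI : MeasurableSet I) (hfg : ∀ x ∈ I, f x ≤ g x)
    (hint : ∀ i j k, IntegrableOn (fun x => x ^ i * f x ^ j * g x ^ k * (g x - f x)) I)
    (h : ∀ x₁ ∈ I, ∀ x₂ ∈ I, ∀ x₃ ∈ I,
      tripleDet x₁ x₂ x₃ (f x₁) (f x₂) (f x₃) * tripleDet x₁ x₂ x₃ (g x₁) (g x₂) (g x₃) ≤ 0) :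
    (gapMoment I f g 0 0 0 * gapMoment I f g 2 0 0 - gapMoment I f g 1 0 0 ^ 2)
        * gapMoment I f g 0 1 1
      - gapMoment I f g 0 0 0 * gapMoment I f g 1 1 0 * gapMoment I f g 1 0 1
      + gapMoment I f g 1 0 0 * (gapMoment I f g 1 1 0 * gapMoment I f g 0 0 1
        + gapMoment I f g 1 0 1 * gapMoment I f g 0 1 0)
      - gapMoment I f g 2 0 0 * gapMoment I f g 0 1 0 * gapMoment I f g 0 0 1 ≤ 0 := by
  generalize hm0 : gapMoment I f g 0 0 0 = m0
  generalize hm1 : gapMoment I f g 1 0 0 = m1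
  generalize hm2 : gapMoment I f g 2 0 0 = m2
  generalize hF : gapMoment I f g 0 1 0 = F
  generalize hG : gapMoment I f g 0 0 1 = G
  generalize hxF : gapMoment I f g 1 1 0 = xF
  generalize hxG : gapMoment I f g 1 0 1 = xG
  generalize hFG : gapMoment I f g 0 1 1 = FG
  have P : ∀ {c₀ c₁ c₂ c₃ c₄ c₅ c₆ c₇ : ℝ},
      (∀ x ∈ I, c₀ + c₁ * x + c₂ * f x + c₃ * g x + c₄ * x ^ 2 + c₅ * (x * f x)
      + c₆ * (x * g x) + c₇ * (f x * g x) ≤ 0) →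
      c₀ * m0 + c₁ * m1 + c₂ * F + c₃ * G + c₄ * m2 + c₅ * xF + c₆ * xG + c₇ * FG ≤ 0 := by
    intro c₀ c₁ c₂ c₃ c₄ c₅ c₆ c₇ hc
    have := gap_quadratic_nonpos hI hfg hint hc
    rwa [hm0, hm1, hm2, hF, hG, hxF, hxG, hFG] at this
  -- integrate out the third point
  have s1 : ∀ a ∈ I, ∀ b ∈ I,
      (a * f b - b * f a) * (a * g b - b * g a) * m0
      + ((a * f b - b * f a) * (g a - g b) + (f a - f b) * (a * g b - b * g a)) * m1
      + (b - a) * (a * g b - b * g a) * F + (b - a) * (a * f b - b * f a) * G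
      + (f a - f b) * (g a - g b) * m2 + (b - a) * (g a - g b) * xF
      + (b - a) * (f a - f b) * xG + (b - a) ^ 2 * FG ≤ 0 := by
    intro a ha b hb
    refine P fun x hx => ?_
    have := h a ha b hb x hx
    simp only [tripleDet] at this
    linarith
  -- then the second point
  have s2 : ∀ a ∈ I,
      (2 * (m0 * m2 - m1 ^ 2)) * (f a * g a)
      + 2 * (m1 * G - m0 * xG) * (a * f a) + 2 * (m1 * F - m0 * xF) * (a * g a)
      + 2 * (m0 * FG - F * G) * a ^ 2
      + 2 * (m1 * xG - m2 * G) * f a + 2 * (m1 * xF - m2 * F) * g a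
      + 2 * (F * xG + G * xF - 2 * m1 * FG) * a
      + 2 * (m2 * FG - xF * xG) ≤ 0 := by
    intro a ha
    -- These are the coefficients of `s1` regrouped as a polynomial in b, f b, g b.
    have := P (c₀ := m2 * f a * g a - xF * a * g a - xG * a * f a + FG * a ^ 2)
      (c₁ := -2 * f a * g a * m1 + F * a * g a + G * a * f a + xF * g a + xG * f a - 2 * a * FG)
      (c₂ := m1 * a * g a - G * a ^ 2 - m2 * g a + xG * a)
      (c₃ := m1 * a * f a - F * a ^ 2 - m2 * f a + xF * a)
      (c₄ := m0 * f a * g a - F * g a - G * f a + FG)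
      (c₅ := -m0 * a * g a + m1 * g a + G * a - xG)
      (c₆ := -m0 * a * f a + m1 * f a + F * a - xF)
      (c₇ := m0 * a ^ 2 - 2 * a * m1 + m2) fun b hb => by linarith [s1 a ha b hb]
    linarith
  have := P (c₀ := 2 * (m2 * FG - xF * xG)) (c₁ := 2 * (F * xG + G * xF - 2 * m1 * FG))
    (c₂ := 2 * (m1 * xG - m2 * G)) (c₃ := 2 * (m1 * xF - m2 * F)) (c₄ := 2 * (m0 * FG - F * G))
    (c₅ := 2 * (m1 * G - m0 * xG)) (c₆ := 2 * (m1 * F - m0 * xF))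
    (c₇ := 2 * (m0 * m2 - m1 ^ 2)) fun a ha => by linarith [s2 a ha]
  -- The triple integral is 3! = 6 times the Gram determinant.
  linarith

theorem integrableOn_gap_monomial (hI : IsCompact I) (hf : Measurable f) (hg : Measurable g)
    {R : ℝ} (hfR : ∀ x ∈ I, |f x| ≤ R) (hgR : ∀ x ∈ I, |g x| ≤ R) (i j k : ℕ) :
    IntegrableOn (fun x => x ^ i * f x ^ j * g x ^ k * (g x - f x)) I := by
  obtain ⟨r, hr⟩ := hI.isBounded.exists_norm_le
  refine Measure.integrableOn_of_bounded (M := r ^ i * R ^ j * R ^ k * (R + R)) hI.measure_lt_top.ne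
    (by fun_prop) ?_
  refine (ae_restrict_iff' hI.measurableSet).2 (Filter.Eventually.of_forall fun x hx => ?_)
  have h1 := hr x hx
  have h2 := hfR x hx
  have h3 := hgR x hx
  have hr0 : 0 ≤ r := (norm_nonneg _).trans h1
  have hR0 : 0 ≤ R := (abs_nonneg _).trans h2
  rw [Real.norm_eq_abs] at h1 ⊢
  simp only [abs_mul, abs_pow]
  gcongr
  exact (abs_sub _ _).trans (add_le_add h3 h2)

end

variable {K : Set (ℝ × ℝ)}

/-- The chord joining two lowest points stays in K, hence above the lower end at `x₂`. This is
convexity of the lower boundary with denominators cleared. -/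
theorem tripleDet_lowerEnd_nonneg (hK : IsCompact K) (hc : Convex ℝ K) {x₁ x₂ x₃ : ℝ}
    (h₁ : x₁ ∈ Prod.fst '' K) (h₃ : x₃ ∈ Prod.fst '' K) (h : x₁ ≤ x₂) (h' : x₂ ≤ x₃) :
    0 ≤ tripleDet x₁ x₂ x₃ (lowerEnd K x₁) (lowerEnd K x₂) (lowerEnd K x₃) := by
  rcases (h.trans h').eq_or_lt with e | hlt
  · have e₁ : x₂ = x₁ := by linarith
    subst e₁ e
    simp [tripleDet]
  have hd : 0 < x₃ - x₁ := sub_pos.2 hlt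
  have := hc (lowerEnd_mem hK h₁) (lowerEnd_mem hK h₃)
    (a := (x₃ - x₂) / (x₃ - x₁)) (b := (x₂ - x₁) / (x₃ - x₁))
    (div_nonneg (by linarith) hd.le) (div_nonneg (by linarith) hd.le) (by field_simp; ring)
  simp only [Prod.smul_mk, smul_eq_mul, Prod.mk_add_mk] at this
  have e : (x₃ - x₂) / (x₃ - x₁) * x₁ + (x₂ - x₁) / (x₃ - x₁) * x₃ = x₂ := by field_simp; ring
  rw [e] at this
  have hle := mul_le_mul_of_nonneg_left (lowerEnd_le hK this) hd.le
  have e' : (x₃ - x₁) * ((x₃ - x₂) / (x₃ - x₁) * lowerEnd K x₁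
      + (x₂ - x₁) / (x₃ - x₁) * lowerEnd K x₃) =
      (x₃ - x₂) * lowerEnd K x₁ + (x₂ - x₁) * lowerEnd K x₃ := by field_simp
  rw [tripleDet]
  linarith

theorem tripleDet_upperEnd_nonpos (hK : IsCompact K) (hc : Convex ℝ K) {x₁ x₂ x₃ : ℝ}
    (h₁ : x₁ ∈ Prod.fst '' K) (h₃ : x₃ ∈ Prod.fst '' K) (h : x₁ ≤ x₂) (h' : x₂ ≤ x₃) :
    tripleDet x₁ x₂ x₃ (upperEnd K x₁) (upperEnd K x₂) (upperEnd K x₃) ≤ 0 := by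
  rcases (h.trans h').eq_or_lt with e | hlt
  · have e₁ : x₂ = x₁ := by linarith
    subst e₁ e
    simp [tripleDet]
  have hd : 0 < x₃ - x₁ := sub_pos.2 hlt
  have := hc (upperEnd_mem hK h₁) (upperEnd_mem hK h₃)
    (a := (x₃ - x₂) / (x₃ - x₁)) (b := (x₂ - x₁) / (x₃ - x₁))
    (div_nonneg (by linarith) hd.le) (div_nonneg (by linarith) hd.le) (by field_simp; ring)
  simp only [Prod.smul_mk, smul_eq_mul, Prod.mk_add_mk] at this
  have e : (x₃ - x₂) / (x₃ - x₁) * x₁ + (x₂ - x₁) / (x₃ - x₁) * x₃ = x₂ := by field_simp; ring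
  rw [e] at this
  have hle := mul_le_mul_of_nonneg_left (le_upperEnd hK this) hd.le
  have e' : (x₃ - x₁) * ((x₃ - x₂) / (x₃ - x₁) * upperEnd K x₁
      + (x₂ - x₁) / (x₃ - x₁) * upperEnd K x₃) =
      (x₃ - x₂) * upperEnd K x₁ + (x₂ - x₁) * upperEnd K x₃ := by field_simp
  rw [tripleDet]
  linarith

theorem abs_ends_le (hK : IsCompact K) : ∃ R, ∀ x ∈ Prod.fst '' K,
    |lowerEnd K x| ≤ R ∧ |upperEnd K x| ≤ R := by
  obtain ⟨R, hR⟩ := hK.isBounded.exists_norm_le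
  exact ⟨R, fun x hx => ⟨(norm_snd_le (x, lowerEnd K x)).trans (hR _ (lowerEnd_mem hK hx)),
    (norm_snd_le (x, upperEnd K x)).trans (hR _ (upperEnd_mem hK hx))⟩⟩

theorem integrableOn_ends (hK : IsCompact K) (i j k : ℕ) :
    IntegrableOn (fun x => x ^ i * lowerEnd K x ^ j * upperEnd K x ^ k *
      (upperEnd K x - lowerEnd K x)) (Prod.fst '' K) := by
  obtain ⟨R, hR⟩ := abs_ends_le hK
  exact integrableOn_gap_monomial (hK.image continuous_fst) (measurable_lowerEnd hK)
    (measurable_upperEnd hK) (fun x hx => (hR x hx).1) (fun x hx => (hR x hx).2) i j k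

/-- Integrating in y leaves a difference of powers divisible by g - f; the quotient, a quadratic in
x, f, g, is what the coefficients record. -/
theorem mom_eq_gapMoment (hK : IsCompact K) (hc : Convex ℝ K) {i j : ℕ}
    (c₀ c₁ c₂ c₃ c₄ c₅ c₆ c₇ c₈ c₉ : ℝ)
    (H : ∀ x f g : ℝ, x ^ i * ((g ^ (j + 1) - f ^ (j + 1)) / (j + 1)) =
      (c₀ + c₁ * x + c₂ * f + c₃ * g + c₄ * x ^ 2 + c₅ * (x * f) + c₆ * (x * g)
      + c₇ * (f * g) + c₈ * f ^ 2 + c₉ * g ^ 2) * (g - f)) :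
    mom i j K =
    c₀ * gapMoment (Prod.fst '' K) (lowerEnd K) (upperEnd K) 0 0 0
      + c₁ * gapMoment (Prod.fst '' K) (lowerEnd K) (upperEnd K) 1 0 0
      + c₂ * gapMoment (Prod.fst '' K) (lowerEnd K) (upperEnd K) 0 1 0
      + c₃ * gapMoment (Prod.fst '' K) (lowerEnd K) (upperEnd K) 0 0 1
      + c₄ * gapMoment (Prod.fst '' K) (lowerEnd K) (upperEnd K) 2 0 0
      + c₅ * gapMoment (Prod.fst '' K) (lowerEnd K) (upperEnd K) 1 1 0
      + c₆ * gapMoment (Prod.fst '' K) (lowerEnd K) (upperEnd K) 1 0 1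
      + c₇ * gapMoment (Prod.fst '' K) (lowerEnd K) (upperEnd K) 0 1 1
      + c₈ * gapMoment (Prod.fst '' K) (lowerEnd K) (upperEnd K) 0 2 0
      + c₉ * gapMoment (Prod.fst '' K) (lowerEnd K) (upperEnd K) 0 0 2 := by
  rw [mom_eq_of_sections hK (hK.image continuous_fst).measurableSet
    (fun x => lowerEnd_le_upperEnd hK) (mem_iff_sections hK hc),
    ← setIntegral_gap_quadratic (integrableOn_ends hK)]
  simp only [H]

theorem mom_shake_eq_gapMoment (hK : IsCompact K) (hc : Convex ℝ K) {i j : ℕ}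
    (c₀ c₁ c₂ c₃ c₄ c₅ c₆ c₇ c₈ c₉ : ℝ)
    (H : ∀ x f g : ℝ, x ^ i * (((g - f) ^ (j + 1) - 0 ^ (j + 1)) / (j + 1)) =
      (c₀ + c₁ * x + c₂ * f + c₃ * g + c₄ * x ^ 2 + c₅ * (x * f) + c₆ * (x * g)
      + c₇ * (f * g) + c₈ * f ^ 2 + c₉ * g ^ 2) * (g - f)) :
    mom i j (shake K) =
    c₀ * gapMoment (Prod.fst '' K) (lowerEnd K) (upperEnd K) 0 0 0
      + c₁ * gapMoment (Prod.fst '' K) (lowerEnd K) (upperEnd K) 1 0 0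
      + c₂ * gapMoment (Prod.fst '' K) (lowerEnd K) (upperEnd K) 0 1 0
      + c₃ * gapMoment (Prod.fst '' K) (lowerEnd K) (upperEnd K) 0 0 1
      + c₄ * gapMoment (Prod.fst '' K) (lowerEnd K) (upperEnd K) 2 0 0
      + c₅ * gapMoment (Prod.fst '' K) (lowerEnd K) (upperEnd K) 1 1 0
      + c₆ * gapMoment (Prod.fst '' K) (lowerEnd K) (upperEnd K) 1 0 1
      + c₇ * gapMoment (Prod.fst '' K) (lowerEnd K) (upperEnd K) 0 1 1
      + c₈ * gapMoment (Prod.fst '' K) (lowerEnd K) (upperEnd K) 0 2 0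
      + c₉ * gapMoment (Prod.fst '' K) (lowerEnd K) (upperEnd K) 0 0 2 := by
  rw [mom_eq_of_sections (isCompact_shake hK) (hK.image continuous_fst).measurableSet
    (fun x hx => sub_nonneg.2 (lowerEnd_le_upperEnd hK hx)) (mem_shake_iff_sections hK hc),
    ← setIntegral_gap_quadratic (integrableOn_ends hK)]
  simp only [H]

theorem area_shake (hK : IsCompact K) (hc : Convex ℝ K) : mom 0 0 (shake K) = mom 0 0 K := by
  rw [mom_eq_gapMoment hK hc 1 0 0 0 0 0 0 0 0 0 (fun x f g => by norm_num),
    mom_shake_eq_gapMoment hK hc 1 0 0 0 0 0 0 0 0 0 (fun x f g => by norm_num)]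

/-- The moments free of y do not change. The mean height on a chord passes from (f + g)/2 to (g -
f)/2, and the second moment in y drops by the integral of fg against g - f. By polarization only the
mixed terms in f and g survive in the difference, and they form the determinant in
`gap_gram_nonpos`. -/
theorem momDet_le_momDet_shake (hK : IsCompact K) (hc : Convex ℝ K) :
    momDet K ≤ momDet (shake K) := by
  have hgram := gap_gram_nonpos (hK.image continuous_fst).measurableSet
    (fun x => lowerEnd_le_upperEnd hK) (integrableOn_ends hK)
    (tripleDet_mul_nonpos
      (fun x₁ h₁ x₂ _ x₃ h₃ h h' => tripleDet_lowerEnd_nonneg hK hc h₁ h₃ h h')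
      (fun x₁ h₁ x₂ _ x₃ h₃ h h' => tripleDet_upperEnd_nonpos hK hc h₁ h₃ h h'))
  simp only [momDet]
  rw [area_shake hK hc, mom_eq_gapMoment (i := 0) (j := 0) hK hc 1 0 0 0 0 0 0 0 0 0
      (fun x f g => by norm_num),
    mom_eq_gapMoment (i := 1) (j := 0) hK hc 0 1 0 0 0 0 0 0 0 0 (fun x f g => by norm_num),
    mom_shake_eq_gapMoment (i := 1) (j := 0) hK hc 0 1 0 0 0 0 0 0 0 0 (fun x f g => by norm_num),
    mom_eq_gapMoment (i := 2) (j := 0) hK hc 0 0 0 0 1 0 0 0 0 0 (fun x f g => by norm_num),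
    mom_shake_eq_gapMoment (i := 2) (j := 0) hK hc 0 0 0 0 1 0 0 0 0 0 (fun x f g => by norm_num),
    mom_eq_gapMoment (i := 0) (j := 1) hK hc 0 0 (1 / 2) (1 / 2) 0 0 0 0 0 0
      (fun x f g => by norm_num; ring),
    mom_shake_eq_gapMoment (i := 0) (j := 1) hK hc 0 0 (-1 / 2) (1 / 2) 0 0 0 0 0 0
      (fun x f g => by norm_num; ring),
    mom_eq_gapMoment (i := 1) (j := 1) hK hc 0 0 0 0 0 (1 / 2) (1 / 2) 0 0 0
      (fun x f g => by norm_num; ring),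
    mom_shake_eq_gapMoment (i := 1) (j := 1) hK hc 0 0 0 0 0 (-1 / 2) (1 / 2) 0 0 0
      (fun x f g => by norm_num; ring),
    mom_eq_gapMoment (i := 0) (j := 2) hK hc 0 0 0 0 0 0 0 (1 / 3) (1 / 3) (1 / 3)
      (fun x f g => by norm_num; ring),
    mom_shake_eq_gapMoment (i := 0) (j := 2) hK hc 0 0 0 0 0 0 0 (-2 / 3) (1 / 3) (1 / 3)
      (fun x f g => by norm_num; ring)]
  linarith

theorem ratio_le_ratio_shake (hK : IsCompact K) (hc : Convex ℝ K) :
    ratio K ≤ ratio (shake K) := by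
  rw [ratio, ratio, area_shake hK hc]
  have : 0 ≤ mom 0 0 K := integral_nonneg fun p => by simp
  exact div_le_div_of_nonneg_right (momDet_le_momDet_shake hK hc) (by positivity)

end

/-! ### Right triangles and their moments -/

section

/-- The right triangle with legs of length `s` along the positive axes. -/
def rightTriangle (s : ℝ) : Set (ℝ × ℝ) := {p | 0 ≤ p.1 ∧ 0 ≤ p.2 ∧ p.1 + p.2 ≤ s}

theorem isCompact_rightTriangle (s : ℝ) : IsCompact (rightTriangle s) := by
  have hsub : rightTriangle s ⊆ Set.Icc 0 s ×ˢ Set.Icc 0 s := by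
    rintro ⟨x, y⟩ ⟨h1, h2, h3⟩
    simp only at h1 h2 h3
    exact ⟨⟨h1, by simp only; linarith⟩, ⟨h2, by simp only; linarith⟩⟩
  have h₁ : IsClosed {p : ℝ × ℝ | 0 ≤ p.1} := isClosed_le (by fun_prop) (by fun_prop)
  have h₂ : IsClosed {p : ℝ × ℝ | 0 ≤ p.2} := isClosed_le (by fun_prop) (by fun_prop)
  have h₃ : IsClosed {p : ℝ × ℝ | p.1 + p.2 ≤ s} := isClosed_le (by fun_prop) (by fun_prop)
  exact (isCompact_Icc.prod isCompact_Icc).of_isClosed_subset (h₁.inter (h₂.inter h₃)) hsub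

theorem mom_rightTriangle_one (i j : ℕ) :
    mom i j (rightTriangle 1) = ∫ x in (0 : ℝ)..1, x ^ i * ((1 - x) ^ (j + 1) / (j + 1)) := by
  rw [mom_eq_of_sections (I := Set.Icc 0 1) (f := fun _ => 0) (g := fun x => 1 - x)
    (isCompact_rightTriangle 1) measurableSet_Icc (fun x hx => sub_nonneg.2 hx.2),
    intervalIntegral.integral_of_le zero_le_one, integral_Icc_eq_integral_Ioc]
  · simp
  · intro x y
    simp only [rightTriangle, Set.mem_ofPred_eq, Set.mem_Icc]
    constructor
    · rintro ⟨h1, h2, h3⟩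
      exact ⟨⟨h1, by linarith⟩, h2, by linarith⟩
    · rintro ⟨⟨h1, h2⟩, h3, h4⟩
      exact ⟨h1, h3, by linarith⟩

theorem integral_cubic (a b c d : ℝ) :
    ∫ x in (0 : ℝ)..1, (a + b * x + c * x ^ 2 + d * x ^ 3) = a + b / 2 + c / 3 + d / 4 := by
  rw [intervalIntegral.integral_add, intervalIntegral.integral_add, intervalIntegral.integral_add]
  · have hb : ∫ x in (0 : ℝ)..1, b * x = b / 2 := by
      rw [intervalIntegral.integral_const_mul, integral_id]
      ring
    simp only [hb, intervalIntegral.integral_const_mul, integral_pow,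
      intervalIntegral.integral_const]
    norm_num
    ring
  all_goals exact Continuous.intervalIntegrable (by fun_prop) _ _

theorem mom_rightTriangle_one_of_eq {i j : ℕ} (a b c d : ℝ)
    (H : ∀ x : ℝ, x ^ i * ((1 - x) ^ (j + 1) / (j + 1)) = a + b * x + c * x ^ 2 + d * x ^ 3) :
    mom i j (rightTriangle 1) = a + b / 2 + c / 3 + d / 4 := by
  rw [mom_rightTriangle_one, ← integral_cubic]
  simp only [H]

theorem ratio_rightTriangle_one :
    mom 0 0 (rightTriangle 1) = 1 / 2 ∧ ratio (rightTriangle 1) = 1 / 108 := by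
  have h00 : mom 0 0 (rightTriangle 1) = 1 / 2 := by
    rw [mom_rightTriangle_one_of_eq 1 (-1) 0 0 (fun x => by norm_num; ring)]; norm_num
  refine ⟨h00, ?_⟩
  rw [ratio, momDet, h00,
    mom_rightTriangle_one_of_eq (i := 1) (j := 0) 0 1 (-1) 0 (fun x => by norm_num; ring),
    mom_rightTriangle_one_of_eq (i := 2) (j := 0) 0 0 1 (-1) (fun x => by norm_num; ring),
    mom_rightTriangle_one_of_eq (i := 0) (j := 1) (1 / 2) (-1) (1 / 2) 0
      (fun x => by norm_num; ring),
    mom_rightTriangle_one_of_eq (i := 1) (j := 1) 0 (1 / 2) (-1) (1 / 2)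
      (fun x => by norm_num; ring),
    mom_rightTriangle_one_of_eq (i := 0) (j := 2) (1 / 3) (-1) 1 (-1 / 3)
      (fun x => by norm_num; ring)]
  norm_num

theorem rightTriangle_eq_image {s : ℝ} (hs : 0 < s) :
    rightTriangle s = planeMap s 0 0 s 0 0 '' rightTriangle 1 := by
  ext ⟨x, y⟩
  constructor
  · rintro ⟨h1, h2, h3⟩
    simp only at h1 h2 h3
    refine ⟨(x / s, y / s), ⟨by simp only; positivity, by simp only; positivity, ?_⟩, ?_⟩
    · simp only
      rw [← add_div, div_le_one hs]
      exact h3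
    · simp only [planeMap_apply, zero_mul, add_zero, zero_add, Prod.mk.injEq]
      constructor <;> field_simp
  · rintro ⟨⟨a, b⟩, ⟨h1, h2, h3⟩, h⟩
    simp only at h1 h2 h3
    simp only [planeMap_apply, zero_mul, add_zero, zero_add, Prod.mk.injEq] at h
    obtain ⟨rfl, rfl⟩ := h
    refine ⟨by simp only; positivity, by simp only; positivity, ?_⟩
    simp only
    nlinarith

theorem mom_rightTriangle {s : ℝ} (hs : 0 < s) (i j : ℕ) :
    mom i j (rightTriangle s) = s ^ (i + j + 2) * mom i j (rightTriangle 1) := by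
  have h : s * s - 0 * 0 ≠ 0 := by simp [hs.ne']
  rw [rightTriangle_eq_image hs, mom, setIntegral_planeMap_image 0 0 h
    (isCompact_rightTriangle 1).measurableSet, mom, ← integral_const_mul, ← integral_const_mul]
  refine integral_congr_ae (Filter.Eventually.of_forall fun p => ?_)
  simp only [planeMap_apply, zero_mul, add_zero, zero_add, sub_zero, abs_mul_abs_self,
    abs_mul, mul_pow]
  ring

theorem rightTriangle_one_subset {K : Set (ℝ × ℝ)} (hc : Convex ℝ K) (h0 : ((0, 0) : ℝ × ℝ) ∈ K)
    (h1 : ((1, 0) : ℝ × ℝ) ∈ K) (h2 : ((0, 1) : ℝ × ℝ) ∈ K) : rightTriangle 1 ⊆ K := by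
  rintro ⟨x, y⟩ ⟨hx, hy, hxy⟩
  simp only at hx hy hxy
  have := hc.sum_mem (t := Finset.univ) (w := ![1 - x - y, x, y])
    (z := ![((0, 0) : ℝ × ℝ), (1, 0), (0, 1)])
    (by intro i _; fin_cases i <;> simp <;> linarith)
    (by simp only [Fin.sum_univ_three, Matrix.cons_val]; ring) (by intro i _; fin_cases i <;> simp [h0, h1, h2])
  simpa [Fin.sum_univ_three] using this

/-- In the first quadrant every monomial is nonnegative; this is why cornered sets are kept there.
-/
theorem mom_mono {K L : Set (ℝ × ℝ)} (hL : IsCompact L) (h : K ⊆ L)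
    (hpos : ∀ p ∈ L, 0 ≤ p.1 ∧ 0 ≤ p.2) (i j : ℕ) : mom i j K ≤ mom i j L := by
  refine setIntegral_mono_set (integrableOn_monomial hL i j) ?_ h.eventuallyLE
  refine (ae_restrict_iff' hL.measurableSet).2 (Filter.Eventually.of_forall fun p hp => ?_)
  have := hpos p hp
  exact mul_nonneg (pow_nonneg this.1 _) (pow_nonneg this.2 _)

/-- A compact convex set in the closed first quadrant that contains the unit right triangle. -/
structure IsCornered (K : Set (ℝ × ℝ)) : Prop where
  isCompact : IsCompact K
  convex : Convex ℝ K
  zero_mem : ((0, 0) : ℝ × ℝ) ∈ K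
  right_mem : ((1, 0) : ℝ × ℝ) ∈ K
  up_mem : ((0, 1) : ℝ × ℝ) ∈ K
  nonneg : ∀ p ∈ K, 0 ≤ p.1 ∧ 0 ≤ p.2

/-! ### Squeezing a cornered set onto a triangle -/

namespace IsCornered

variable {K : Set (ℝ × ℝ)}

theorem rightTriangle_subset (h : IsCornered K) : rightTriangle 1 ⊆ K :=
  rightTriangle_one_subset h.convex h.zero_mem h.right_mem h.up_mem

theorem half_le_area (h : IsCornered K) : 1 / 2 ≤ mom 0 0 K := by
  rw [← ratio_rightTriangle_one.1]
  exact mom_mono h.isCompact h.rightTriangle_subset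
    h.nonneg 0 0

/-- Shaking parallel to the hypotenuse, followed by a rescaling. -/
theorem exists_shaken (h : IsCornered K) : ∃ S K', 1 ≤ S ∧ IsCornered K' ∧
    K ⊆ rightTriangle S ∧ ratio K ≤ ratio K' ∧ mom 0 0 K' = mom 0 0 K / S := by
  obtain ⟨q, hq, hmax⟩ := h.isCompact.exists_isMaxOn ⟨_, h.zero_mem⟩
    (f := fun p : ℝ × ℝ => p.1 + p.2) (by fun_prop)
  set S := q.1 + q.2 with hS
  have hS1 : 1 ≤ S := by simpa using hmax h.right_mem
  have hS0 : 0 < S := by linarith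
  have d1 : (1 : ℝ) * 0 - 1 * 1 ≠ 0 := by norm_num
  have d2 : (0 : ℝ) * (-(1 / S)) - 1 * (1 / S) ≠ 0 := by
    have : 1 / S ≠ 0 := by positivity
    simpa using this
  set K₁ := planeMap 1 1 1 0 0 0 '' K with hK₁
  have c₁ : IsCompact K₁ := h.isCompact.image (continuous_planeMap _ _ _ _ _ _)
  have v₁ : Convex ℝ K₁ := h.convex.affine_image _
  have mem₁ : ∀ s t, (s, t) ∈ K₁ ↔ (t, s - t) ∈ K := by
    intro s t
    constructor
    · rintro ⟨⟨x, y⟩, hp, he⟩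
      simp only [planeMap_apply, Prod.mk.injEq] at he
      obtain ⟨rfl, rfl⟩ := he
      convert hp using 2 <;> simp
    -- The coordinates are s = x + y and t = x, so vertical chords of `K₁` are the chords of K
    -- parallel to the hypotenuse.
    · intro hp
      exact ⟨_, hp, by simp [planeMap_apply]⟩
  have c₂ := isCompact_shake c₁
  have v₂ := convex_shake v₁
  -- The map undoes the change of coordinates and divides the height by S. The point of K maximizing
  -- x + y slides to (0, S) and then to (0, 1), while the chord from (0, 1) to (1, 0) keeps (1, 0)
  -- in the image.
  refine ⟨S, planeMap 0 1 (1 / S) (-(1 / S)) 0 0 '' shake K₁, hS1, ⟨?_, ?_, ?_, ?_, ?_, ?_⟩,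
    ?_, ?_, ?_⟩
  · exact c₂.image (continuous_planeMap _ _ _ _ _ _)
  · exact v₂.affine_image _
  · exact ⟨(0, 0), mem_shake.2 ⟨le_rfl, 0, by simpa [mem₁] using h.zero_mem⟩,
      by simp [planeMap_apply]⟩
  · refine ⟨(1, 1), mem_shake.2 ⟨zero_le_one, 0, ?_, ?_⟩, by simp [planeMap_apply]⟩
    · simpa [mem₁] using h.up_mem
    · simpa [mem₁] using h.right_mem
  · refine ⟨(S, 0), mem_shake.2 ⟨le_rfl, q.1, ?_⟩, ?_⟩
    · simpa [mem₁, hS] using hq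
    · simp [planeMap_apply, hS0.ne']
  · rintro _ ⟨⟨s, t⟩, hp, rfl⟩
    obtain ⟨ht, z, hz1, hz2⟩ := mem_shake.1 hp
    rw [mem₁] at hz1 hz2
    have h1 := (h.nonneg _ hz1).1
    have h2 := (h.nonneg _ hz2).2
    simp only at h1 h2
    simp only [planeMap_apply]
    refine ⟨by linarith, ?_⟩
    have : 1 / S * s + -(1 / S) * t + 0 = 1 / S * (s - t) := by ring
    rw [this]
    exact mul_nonneg (by positivity) (by linarith)
  · intro p hp
    exact ⟨(h.nonneg p hp).1, (h.nonneg p hp).2, hmax hp⟩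
  · rw [ratio_planeMap_image 0 0 d2 c₂, ← ratio_planeMap_image 0 0 d1 h.isCompact]
    exact ratio_le_ratio_shake c₁ v₁
  · rw [area_planeMap_image 0 0 d2 c₂, area_shake c₁ v₁, area_planeMap_image 0 0 d1 h.isCompact]
    have : |(0 : ℝ) * (-(1 / S)) - 1 * (1 / S)| = 1 / S := by
      rw [zero_mul, zero_sub, abs_neg, one_mul, abs_of_pos (by positivity)]
    rw [this]
    norm_num
    field_simp

/-- A near-minimizer of area cannot have its area divided by much more than 1, because the shaken
set still competes for the infimum. The bound 1/2 keeps the infimum positive, so a relative error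
makes sense. -/
theorem exists_near_triangle (h : IsCornered K) {ε : ℝ} (hε : 0 < ε) :
    ∃ K', IsCornered K' ∧ ratio K ≤ ratio K' ∧ K' ⊆ rightTriangle (1 + ε) := by
  set A : Set ℝ := {a | ∃ K', IsCornered K' ∧ ratio K ≤ ratio K' ∧ a = mom 0 0 K'} with hA
  have hne : A.Nonempty := ⟨_, K, h, le_rfl, rfl⟩
  have hlb : ∀ a ∈ A, (1 / 2 : ℝ) ≤ a := by
    rintro _ ⟨K', h', _, rfl⟩
    exact h'.half_le_area
  have hpos : 1 / 2 ≤ sInf A := le_csInf hne hlb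
  have hlt : sInf A < sInf A * (1 + ε) := by nlinarith
  obtain ⟨a, ⟨K', h', hr, rfl⟩, ha⟩ := exists_lt_of_csInf_lt hne hlt
  obtain ⟨S, K'', hS, h'', hsub, hr', harea⟩ := h'.exists_shaken
  have hle : sInf A ≤ mom 0 0 K' / S :=
    csInf_le ⟨1 / 2, hlb⟩ ⟨K'', h'', hr.trans hr', harea.symm⟩
  rw [le_div_iff₀ (by linarith)] at hle
  have hS' : S ≤ 1 + ε := by nlinarith
  exact ⟨K', h', hr, fun p hp => ⟨(hsub hp).1, (hsub hp).2.1, (hsub hp).2.2.trans hS'⟩⟩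

/-- Each moment of the near-triangles is squeezed between those of the unit triangle and of its
dilates by 1 + 1/(n + 1), and `ratio` is continuous in the moments where the area is nonzero. -/
theorem ratio_le (h : IsCornered K) : ratio K ≤ 1 / 108 := by
  have hε : ∀ n : ℕ, (0 : ℝ) < 1 / ((n : ℝ) + 1) := fun n => by positivity
  choose L hL hr hsub using fun n => h.exists_near_triangle (hε n)
  have hmom : ∀ i j, Filter.Tendsto (fun n => mom i j (L n)) Filter.atTop
      (nhds (mom i j (rightTriangle 1))) := by
    intro i j
    have hlim : Filter.Tendsto (fun n : ℕ => (1 + 1 / ((n : ℝ) + 1)) ^ (i + j + 2) *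
        mom i j (rightTriangle 1)) Filter.atTop (nhds (mom i j (rightTriangle 1))) := by
      have := ((tendsto_one_div_add_atTop_nhds_zero_nat (𝕜 := ℝ)).const_add 1).pow (i + j + 2)
        |>.mul_const (mom i j (rightTriangle 1))
      simpa using this
    refine tendsto_of_tendsto_of_tendsto_of_le_of_le tendsto_const_nhds hlim (fun n => ?_)
      (fun n => ?_)
    · exact mom_mono (hL n).isCompact
        (hL n).rightTriangle_subset (hL n).nonneg i j
    · simp only
      rw [← mom_rightTriangle (by have := hε n; linarith)]
      exact mom_mono (isCompact_rightTriangle _) (hsub n)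
        (fun p hp => ⟨hp.1, hp.2.1⟩) i j
  have hdet : Filter.Tendsto (fun n => momDet (L n)) Filter.atTop
      (nhds (momDet (rightTriangle 1))) :=
    (((hmom 0 0).mul (((hmom 2 0).mul (hmom 0 2)).sub ((hmom 1 1).pow 2))).sub
      ((hmom 1 0).mul (((hmom 1 0).mul (hmom 0 2)).sub ((hmom 1 1).mul (hmom 0 1))))).add
      ((hmom 0 1).mul (((hmom 1 0).mul (hmom 1 1)).sub ((hmom 2 0).mul (hmom 0 1))))
  have hratio : Filter.Tendsto (fun n => ratio (L n)) Filter.atTop (nhds (1 / 108)) := by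
    rw [← ratio_rightTriangle_one.2]
    refine hdet.div ((hmom 0 0).pow 5) ?_
    rw [ratio_rightTriangle_one.1]
    norm_num
  exact ge_of_tendsto hratio (Filter.Eventually.of_forall hr)

end IsCornered

/-- Among planar convex bodies, `det Cov(K) / |K|²` is at most its value at triangles. -/
theorem ratio_le_of_interior_nonempty {K : Set (ℝ × ℝ)} (hK : IsCompact K) (hc : Convex ℝ K)
    (hi : (interior K).Nonempty) : ratio K ≤ 1 / 108 := by
  obtain ⟨⟨u, v⟩, huv⟩ := hi
  obtain ⟨r, hr, hball⟩ := Metric.isOpen_iff.1 isOpen_interior _ huv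
  have near : ∀ x y : ℝ, |x| < r → |y| < r → (u + x, v + y) ∈ K := by
    intro x y hx hy
    refine interior_subset (hball ?_)
    rw [Metric.mem_ball, Prod.dist_eq, Real.dist_eq, Real.dist_eq]
    simpa using ⟨hx, hy⟩
  have hr2 : |r / 2| < r := by rw [abs_of_pos (by positivity)]; linarith
  have hr2' : |-(r / 2)| < r := by rwa [abs_neg]
  have hr0 : |(0 : ℝ)| < r := by simpa using hr
  -- after the first shaking
  have c₁ := isCompact_shake hK
  have v₁ := convex_shake hc
  have dswap : (0 : ℝ) * 0 - 1 * 1 ≠ 0 := by norm_num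
  set K₂ := planeMap 0 1 1 0 0 0 '' shake K with hK₂
  have mem₂ : ∀ x y, (x, y) ∈ K₂ ↔ (y, x) ∈ shake K := by
    intro x y
    constructor
    · rintro ⟨⟨a, b⟩, hp, he⟩
      simp only [planeMap_apply, Prod.mk.injEq] at he
      obtain ⟨rfl, rfl⟩ := he
      simpa using hp
    · intro hp
      exact ⟨_, hp, by simp [planeMap_apply]⟩
  have c₂ : IsCompact K₂ := c₁.image (continuous_planeMap _ _ _ _ _ _)
  have v₂ : Convex ℝ K₂ := v₁.affine_image _
  have base : ∀ x, |x| < r → (u + x, (0 : ℝ)) ∈ shake K := fun x hx =>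
    mem_shake.2 ⟨le_rfl, v, by simpa using near x 0 hx hr0, by simpa using near x 0 hx hr0⟩
  -- The vertical segment of length r centred at (u, v) lies in K and slides down onto the axis.
  have apex : (u, r) ∈ shake K := by
    refine mem_shake.2 ⟨hr.le, v + -(r / 2), by simpa using near 0 _ hr0 hr2', ?_⟩
    have := near 0 _ hr0 hr2
    rw [add_zero] at this
    convert this using 2
    ring
  -- after the second shaking
  have c₃ := isCompact_shake c₂
  have v₃ := convex_shake v₂
  have nonneg₃ : ∀ p ∈ shake K₂, 0 ≤ p.1 ∧ 0 ≤ p.2 := by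
    rintro ⟨x, y⟩ hp
    obtain ⟨hy, z, hz, _⟩ := mem_shake.1 hp
    exact ⟨(mem_shake.1 ((mem₂ _ _).1 hz)).1, hy⟩
  have m0 : ((0, 0) : ℝ × ℝ) ∈ shake K₂ :=
    mem_shake.2 ⟨le_rfl, u, (mem₂ _ _).2 (by simpa using base 0 hr0),
      (mem₂ _ _).2 (by simpa using base 0 hr0)⟩
  have m1 : ((r, 0) : ℝ × ℝ) ∈ shake K₂ :=
    mem_shake.2 ⟨le_rfl, u, (mem₂ _ _).2 apex, (mem₂ _ _).2 (by simpa using apex)⟩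
  have m2 : ((0, r) : ℝ × ℝ) ∈ shake K₂ := by
    refine mem_shake.2 ⟨hr.le, u + -(r / 2), (mem₂ _ _).2 (base _ hr2'), (mem₂ _ _).2 ?_⟩
    convert base _ hr2 using 2
    ring
  have dr : r⁻¹ * r⁻¹ - 0 * 0 ≠ 0 := by
    rw [mul_zero, sub_zero]; positivity
  have hcorner : IsCornered (planeMap r⁻¹ 0 0 r⁻¹ 0 0 '' shake K₂) := by
    refine ⟨c₃.image (continuous_planeMap _ _ _ _ _ _), v₃.affine_image _, ?_, ?_, ?_, ?_⟩
    · exact ⟨_, m0, by simp [planeMap_apply]⟩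
    · exact ⟨_, m1, by simp [planeMap_apply, hr.ne']⟩
    · exact ⟨_, m2, by simp [planeMap_apply, hr.ne']⟩
    · rintro _ ⟨p, hp, rfl⟩
      obtain ⟨h1, h2⟩ := nonneg₃ p hp
      simp only [planeMap_apply, zero_mul, add_zero, zero_add]
      exact ⟨by positivity, by positivity⟩
  calc ratio K ≤ ratio (shake K) := ratio_le_ratio_shake hK hc
    _ = ratio K₂ := (ratio_planeMap_image 0 0 dswap c₁).symm
    _ ≤ ratio (shake K₂) := ratio_le_ratio_shake c₂ v₂
    _ = ratio (planeMap r⁻¹ 0 0 r⁻¹ 0 0 '' shake K₂) := (ratio_planeMap_image 0 0 dr c₃).symm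
    _ ≤ 1 / 108 := hcorner.ratio_le

end

/-! ### Positivity of the moment determinant -/

section

variable {K : Set (ℝ × ℝ)}

theorem exists_square_subset (hi : (interior K).Nonempty) :
    ∃ u v s : ℝ, 0 < s ∧ (u, v) ∈ interior K ∧ (u + s, v) ∈ interior K ∧
      (u, v + s) ∈ interior K := by
  obtain ⟨⟨u, v⟩, huv⟩ := hi
  obtain ⟨r, hr, hball⟩ := Metric.isOpen_iff.1 isOpen_interior _ huv
  refine ⟨u, v, r / 2, by positivity, huv, hball ?_, hball ?_⟩ <;>
    simp [Prod.dist_eq, abs_of_pos hr, hr]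

/-- The matrix of moments of a set with interior points is positive definite. -/
theorem moment_form_pos (hK : IsCompact K) (hi : (interior K).Nonempty) {a b c : ℝ}
    (h : a ≠ 0 ∨ b ≠ 0 ∨ c ≠ 0) :
    0 < a ^ 2 * mom 0 0 K + 2 * a * b * mom 1 0 K + 2 * a * c * mom 0 1 K + b ^ 2 * mom 2 0 K
      + 2 * b * c * mom 1 1 K + c ^ 2 * mom 0 2 K := by
  rw [← setIntegral_quadratic hK]
  have hcont : Continuous fun p : ℝ × ℝ => (a + b * p.1 + c * p.2) ^ 2 := by fun_prop
  have e : ∫ p in K, (a ^ 2 * (p.1 ^ 0 * p.2 ^ 0) + 2 * a * b * (p.1 ^ 1 * p.2 ^ 0)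
      + 2 * a * c * (p.1 ^ 0 * p.2 ^ 1) + b ^ 2 * (p.1 ^ 2 * p.2 ^ 0)
      + 2 * b * c * (p.1 ^ 1 * p.2 ^ 1) + c ^ 2 * (p.1 ^ 0 * p.2 ^ 2)) =
      ∫ p in K, (a + b * p.1 + c * p.2) ^ 2 :=
    integral_congr_ae (Filter.Eventually.of_forall fun p => by ring)
  rw [e, setIntegral_pos_iff_support_of_nonneg_ae
    (Filter.Eventually.of_forall fun p => sq_nonneg _)
    (hcont.continuousOn.integrableOn_compact hK)]
  have hopen : IsOpen (Function.support (fun p : ℝ × ℝ => (a + b * p.1 + c * p.2) ^ 2)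
      ∩ interior K) := hcont.isOpen_support.inter isOpen_interior
  refine (hopen.measure_pos volume ?_).trans_le
    (measure_mono (Set.inter_subset_inter_right _ interior_subset))
  obtain ⟨u, v, s, hs, h1, h2, h3⟩ := exists_square_subset hi
  by_contra hne
  have zero : ∀ p ∈ interior K, a + b * p.1 + c * p.2 = 0 := by
    intro p hp
    by_contra hp0
    exact hne ⟨p, by simpa using hp0, hp⟩
  have z1 := zero _ h1
  have z2 := zero _ h2
  have z3 := zero _ h3
  simp only at z1 z2 z3
  have hb : b = 0 := (mul_eq_zero.1 (by linarith : b * s = 0)).resolve_right hs.ne'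
  have hc : c = 0 := (mul_eq_zero.1 (by linarith : c * s = 0)).resolve_right hs.ne'
  subst hb hc
  simp_all

theorem area_pos (hK : IsCompact K) (hi : (interior K).Nonempty) : 0 < mom 0 0 K := by
  simpa using moment_form_pos hK hi (a := 1) (b := 0) (c := 0) (by simp)

theorem momDet_pos (hK : IsCompact K) (hi : (interior K).Nonempty) : 0 < momDet K := by
  have hA := area_pos hK hi
  have hV : 0 < mom 0 0 K * mom 2 0 K - mom 1 0 K ^ 2 := by
    have := moment_form_pos hK hi (a := -mom 1 0 K) (b := mom 0 0 K) (c := 0) (by simp [hA.ne'])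
    refine pos_of_mul_pos_right (a := mom 0 0 K) ?_ hA.le
    linarith
  -- The test vector is the last column of the adjugate of the moment matrix, where the form equals
  -- `momDet K` times the leading 2×2 minor.
  have := moment_form_pos hK hi (a := mom 1 0 K * mom 1 1 K - mom 2 0 K * mom 0 1 K)
    (b := mom 1 0 K * mom 0 1 K - mom 0 0 K * mom 1 1 K)
    (c := mom 0 0 K * mom 2 0 K - mom 1 0 K ^ 2) (Or.inr (Or.inr hV.ne'))
  refine pos_of_mul_pos_right (a := mom 0 0 K * mom 2 0 K - mom 1 0 K ^ 2) ?_ hV.le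
  rw [momDet]
  linarith

end

/-! ### The value at triangles -/

theorem convexHull_eq_rightTriangle :
    convexHull ℝ {((0, 0) : ℝ × ℝ), (1, 0), (0, 1)} = rightTriangle 1 := by
  apply Set.Subset.antisymm
  · refine convexHull_min ?_ ?_
    · rintro p (rfl | rfl | rfl) <;> norm_num [rightTriangle]
    · rintro ⟨x, y⟩ ⟨h1, h2, h3⟩ ⟨x', y'⟩ ⟨h1', h2', h3'⟩ a b ha hb hab
      simp only at h1 h2 h3 h1' h2' h3'
      simp only [rightTriangle, Prod.smul_mk, smul_eq_mul, Prod.mk_add_mk, Set.mem_ofPred_eq]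
      refine ⟨by positivity, by positivity, ?_⟩
      nlinarith
  · exact rightTriangle_one_subset (convex_convexHull ℝ _)
      (subset_convexHull ℝ _ (by simp)) (subset_convexHull ℝ _ (by simp))
      (subset_convexHull ℝ _ (by simp))

theorem ratio_triangle {p q r : ℝ × ℝ}
    (h : (q.1 - p.1) * (r.2 - p.2) - (r.1 - p.1) * (q.2 - p.2) ≠ 0) :
    mom 0 0 (convexHull ℝ {p, q, r}) ≠ 0 ∧ ratio (convexHull ℝ {p, q, r}) = 1 / 108 := by
  have e : convexHull ℝ {p, q, r} =
      planeMap (q.1 - p.1) (r.1 - p.1) (q.2 - p.2) (r.2 - p.2) p.1 p.2 '' rightTriangle 1 := by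
    rw [← convexHull_eq_rightTriangle, AffineMap.image_convexHull, Set.image_insert_eq,
      Set.image_pair]
    simp [planeMap_apply]
  rw [e, ratio_planeMap_image _ _ h (isCompact_rightTriangle 1),
    area_planeMap_image _ _ h (isCompact_rightTriangle 1), ratio_rightTriangle_one.1,
    ratio_rightTriangle_one.2]
  exact ⟨mul_ne_zero (abs_ne_zero.2 h) (by norm_num), rfl⟩

/-! ### Transfer to the Euclidean plane -/

/-- The coordinates of a point of the Euclidean plane. -/
noncomputable def coords : EuclideanSpace ℝ (Fin 2) ≃L[ℝ] ℝ × ℝ :=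
  (EuclideanSpace.equiv (Fin 2) ℝ).trans (ContinuousLinearEquiv.finTwoArrow ℝ ℝ)

theorem measurePreserving_coords : MeasurePreserving coords :=
  (volume_preserving_finTwoArrow ℝ).comp (PiLp.volume_preserving_ofLp (Fin 2))

variable {K : Set (EuclideanSpace ℝ (Fin 2))}

theorem setIntegral_coords (F : ℝ × ℝ → ℝ) :
    ∫ x in K, F (x 0, x 1) = ∫ p in coords '' K, F p := by
  rw [← measurePreserving_coords.setIntegral_preimage_emb
    coords.toHomeomorph.measurableEmbedding,
    Set.preimage_image_eq _ coords.injective]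
  rfl

theorem isoC_eq_inv_ratio (h : mom 0 0 (coords '' K) ≠ 0) :
    isoC K = (ratio (coords '' K))⁻¹ := by
  have hA : volume.real K = mom 0 0 (coords '' K) := by
    have := setIntegral_coords (K := K) (fun _ => 1)
    simpa [mom] using this
  have h10 : ∫ x in K, x 0 = mom 1 0 (coords '' K) := by
    simpa [mom] using setIntegral_coords (K := K) (fun p => p.1)
  have h01 : ∫ x in K, x 1 = mom 0 1 (coords '' K) := by
    simpa [mom] using setIntegral_coords (K := K) (fun p => p.2)
  have h20 : ∫ x in K, x 0 * x 0 = mom 2 0 (coords '' K) := by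
    simpa [mom, sq] using setIntegral_coords (K := K) (fun p => p.1 * p.1)
  have h11 : ∫ x in K, x 0 * x 1 = mom 1 1 (coords '' K) := by
    simpa [mom] using setIntegral_coords (K := K) (fun p => p.1 * p.2)
  have h11' : ∫ x in K, x 1 * x 0 = mom 1 1 (coords '' K) := by
    simpa [mom, mul_comm] using setIntegral_coords (K := K) (fun p => p.2 * p.1)
  have h02 : ∫ x in K, x 1 * x 1 = mom 0 2 (coords '' K) := by
    simpa [mom, sq] using setIntegral_coords (K := K) (fun p => p.2 * p.2)
  have hdet : (cov K).det = momDet (coords '' K) / mom 0 0 (coords '' K) ^ 3 := by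
    rw [Matrix.det_fin_two]
    simp only [cov, Matrix.of_apply, h10, h01, h20, h11, h11', h02, hA, momDet]
    field_simp
    ring
  rw [isoC, hdet, hA, ratio, inv_div, div_div_eq_mul_div, ← pow_add]

theorem le_isoC (hK : IsCompact K) (hc : Convex ℝ K) (hi : (interior K).Nonempty) :
    108 ≤ isoC K := by
  have hK' : IsCompact (coords '' K) := hK.image coords.continuous
  have hc' : Convex ℝ (coords '' K) := hc.linear_image coords.toLinearEquiv.toLinearMap
  have hi' : (interior (coords '' K)).Nonempty := by
    have := coords.toHomeomorph.image_interior K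
    have h2 : (coords '' interior K).Nonempty := hi.image _
    exact h2.mono this.subset
  have hA := area_pos hK' hi'
  rw [isoC_eq_inv_ratio hA.ne']
  have h1 := ratio_le_of_interior_nonempty hK' hc' hi'
  -- Strict positivity is what allows the upper bound on the ratio to be inverted.
  have h0 : 0 < ratio (coords '' K) := div_pos (momDet_pos hK' hi') (by positivity)
  rw [le_inv_comm₀ (by norm_num) h0]
  linarith

theorem isoC_triangle {p q r : EuclideanSpace ℝ (Fin 2)}
    (h : (q 0 - p 0) * (r 1 - p 1) - (r 0 - p 0) * (q 1 - p 1) ≠ 0) :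
    isoC (convexHull ℝ {p, q, r}) = 108 := by
  have e : coords '' convexHull ℝ {p, q, r} = convexHull ℝ {coords p, coords q, coords r} := by
    have := coords.toLinearEquiv.toLinearMap.image_convexHull {p, q, r}
    rw [Set.image_insert_eq, Set.image_pair] at this
    exact this
  obtain ⟨h1, h2⟩ := ratio_triangle (p := coords p) (q := coords q) (r := coords r) h
  rw [← e] at h1 h2
  rw [isoC_eq_inv_ratio h1, h2]
  norm_num

theorem isoC_simplexZero : isoC (simplexZero 2) = 108 := by
  have e : simplexZero 2 = convexHull ℝ {-∑ i : Fin 2, EuclideanSpace.single i (1 : ℝ),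
      EuclideanSpace.single 0 1, EuclideanSpace.single 1 1} := by
    rw [simplexZero]
    congr 2
    ext x
    simp [Fin.exists_fin_two, eq_comm]
  rw [e]
  refine isoC_triangle ?_
  norm_num [Fin.sum_univ_two]

theorem isoC_convexHull_range {v : Fin 3 → EuclideanSpace ℝ (Fin 2)}
    (hv : AffineIndependent ℝ v) : isoC (convexHull ℝ (Set.range v)) = 108 := by
  have e : Set.range v = {v 0, v 1, v 2} := by
    ext x
    simp [Fin.exists_fin_succ, eq_comm]
  rw [e]
  refine isoC_triangle fun h0 => ?_
  rw [affineIndependent_iff] at hv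
  have key : ∀ a b : ℝ, a • (v 1 - v 0) + b • (v 2 - v 0) = 0 → a = 0 ∧ b = 0 := by
    intro a b hab
    have hs := hv Finset.univ ![-a - b, a, b]
      (by simp only [Fin.sum_univ_three, Matrix.cons_val]; ring) (by
      rw [← hab]
      simp only [Fin.sum_univ_three, Matrix.cons_val]
      module)
    exact ⟨hs 1 (Finset.mem_univ _), hs 2 (Finset.mem_univ _)⟩
  -- With these weights one coordinate of the combination cancels identically and the other is the
  -- vanishing determinant up to sign. The two choices together force v 1 = v 0, contradicting
  -- independence.
  have k1 := key (v 2 0 - v 0 0) (-(v 1 0 - v 0 0)) (by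
    ext k
    fin_cases k <;> simp <;> linarith)
  have k2 := key (v 2 1 - v 0 1) (-(v 1 1 - v 0 1)) (by
    ext k
    fin_cases k <;> simp <;> linarith)
  have := key 1 0 (by
    ext k
    fin_cases k <;> simp <;> linarith)
  exact one_ne_zero this.1

end PlaneSlicing

theorem mainTheorem5 :
    (∀ K : ConvexBody (EuclideanSpace ℝ (Fin 2)),
      (interior (K : Set (EuclideanSpace ℝ (Fin 2)))).Nonempty →
        PlaneSlicing.isoC (PlaneSlicing.simplexZero 2) ≤
          PlaneSlicing.isoC (K : Set (EuclideanSpace ℝ (Fin 2)))) ∧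
    PlaneSlicing.isoC (PlaneSlicing.simplexZero 2) = 108 ∧
    (∀ v : Fin 3 → EuclideanSpace ℝ (Fin 2), AffineIndependent ℝ v →
      PlaneSlicing.isoC (convexHull ℝ (Set.range v)) = 108) :=
  ⟨fun K hi => PlaneSlicing.isoC_simplexZero.trans_le
      (PlaneSlicing.le_isoC K.isCompact K.convex hi),
    PlaneSlicing.isoC_simplexZero, fun _ hv => PlaneSlicing.isoC_convexHull_range hv⟩
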